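/- Let $n$ be a natural number and $\mathbb{R}_+=[0,\infty)$. A *phase-type representation* of dimension $p\ge 1$ is a pair $(\pi,T)$ of a probability (row) vector $\pi\in\mathbb{R}_+^p$ and a real $p\times p$ matrix $T$ whose off-diagonal entries are non-negative, whose exit vector $t=-Te$ ($e$ the vector of ones) is non-negative, and such that all $p$ states of the Markov jump process with jump rates $T_{ij}$ between the states and absorption rates $t_i$ are transient, i.e. absorption is possible from every state. For $\alpha\in(0,1]^n$, a phase-type representation $(\pi,T)$ of dimension $p$ and a non-negative $p\times n$ matrix $R$, a random vector $X$ in $\mathbb{R}_+^n$ is said to have the distribution $\mathrm{GMML}(\alpha,\pi,T,R)$ if $$\mathbb{E}\,e^{-\langle u,X\rangle}=\pi\left(\Delta(Ru^{\alpha})-T\right)^{-1}t\qquad\text{for all }u\in\mathbb{R}_+^n,$$ where $u^\alpha=(u_1^{\alpha_1},\dots,u_n^{\alpha_n})$ and $\Delta(v)$ is the diagonal matrix with diagonal $v$. For $\nu\in(0,\infty)^n$, $\mathrm{GMML}^{1/\nu}(\alpha,\pi,T,R)$ is then the distribution of $X^{1/\nu}=(X_1^{1/\nu_1},\dots,X_n^{1/\nu_n})$.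 Call a class of distributions dense on $\mathbb{R}_+^n$ if it is dense, in the topology of weak convergence, in the set of all probability distributions on $\mathbb{R}_+^n$. Then: (i) The class of all distributions $\mathrm{GMML}(\alpha,\pi,T,R)$ ($\alpha\in(0,1]^n$ and $p,\pi,T,R$ arbitrary) is dense on $\mathbb{R}_+^n$. (ii) For every fixed $\alpha\in(0,1]^n$, the class of all distributions $\mathrm{GMML}^{1/\nu}(\alpha,\pi,T,R)$ ($\nu\in(0,\infty)^n$ and $p,\pi,T,R$ arbitrary) is dense on $\mathbb{R}_+^n$. (iii) For every fixed $\gamma\in(0,\infty)^n$, the class of all distributions $\mathrm{GMML}^{1/\nu}(\alpha,\pi,T,R)$ with $\alpha\in(0,1)^n$, $\nu\in(0,\infty)^n$ and $\alpha_i\nu_i=\gamma_i^{-1}$ for $i=1,\dots,n$ ($p,\pi,T,R$ arbitrary) is dense on $\mathbb{R}_+^n$; hence so is the larger class in which $\alpha\in(0,1]^n$. -/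

import Mathlib

open MeasureTheory
open scoped NNReal Matrix

noncomputable section

namespace MatrixMittagLeffler

/-- The exit rate vector `t = -T e` of a matrix `T`, where `e` is the vector of ones. -/
def exitRate {p : ℕ} (T : Matrix (Fin p) (Fin p) ℝ) : Fin p → ℝ :=
  -(T *ᵥ 1)

/-- `(π, T)` is a phase-type representation of dimension `p`: `π` is a probability vector and `T` is
the sub-intensity matrix of a Markov jump process on `p` transient states and one absorbing state,
started in the transient states. As the state space is finite, all `p` states are transient exactly
when from each of them the absorbing state can be reached by jumps of positive rate. Since
`∑ i, π i = 1`, the dimension `p` is positive. -/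
structure IsPhaseTypeRep {p : ℕ} (π : Fin p → ℝ) (T : Matrix (Fin p) (Fin p) ℝ) : Prop where
  init_nonneg : ∀ i, 0 ≤ π i
  init_sum : ∑ i, π i = 1
  rate_nonneg : ∀ i j, i ≠ j → 0 ≤ T i j
  exit_nonneg : ∀ i, 0 ≤ exitRate T i
  transient : ∀ i, ∃ j, Relation.ReflTransGen (fun a b => a ≠ b ∧ 0 < T a b) i j ∧ 0 < exitRate T j

/-- The joint Laplace transform `u ↦ E exp(-⟨u, X⟩)` of a random vector `X` in `[0, ∞)ⁿ`
with law `P`. -/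
def laplace {n : ℕ} (P : ProbabilityMeasure (Fin n → ℝ≥0)) (u : Fin n → ℝ≥0) : ℝ :=
  ∫ x, Real.exp (-∑ i, (u i : ℝ) * (x i : ℝ)) ∂(P : Measure (Fin n → ℝ≥0))

/-- The function `u ↦ π (Δ(R u^α) - T)⁻¹ t` with `u^α = (u₁^α₁, …, uₙ^αₙ)` and `t = -T e`. -/
def gmmlTransform {n p : ℕ} (α : Fin n → ℝ) (π : Fin p → ℝ) (T : Matrix (Fin p) (Fin p) ℝ)
    (R : Matrix (Fin p) (Fin n) ℝ) (u : Fin n → ℝ≥0) : ℝ :=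
  π ⬝ᵥ ((Matrix.diagonal (R *ᵥ fun i => (u i : ℝ) ^ α i) - T)⁻¹ *ᵥ exitRate T)

/-- `P` is the law of a random vector `X ~ GMML(α, π, T, R)`: the indices satisfy `0 < αᵢ ≤ 1`,
`(π, T)` is a phase-type representation, `R` is a non-negative reward matrix, and `X` has joint
Laplace transform `π (Δ(R u^α) - T)⁻¹ t` on `[0, ∞)ⁿ`. -/
structure IsGMML {n p : ℕ} (α : Fin n → ℝ) (π : Fin p → ℝ) (T : Matrix (Fin p) (Fin p) ℝ)
    (R : Matrix (Fin p) (Fin n) ℝ) (P : ProbabilityMeasure (Fin n → ℝ≥0)) : Prop where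
  index_pos : ∀ i, 0 < α i
  index_le_one : ∀ i, α i ≤ 1
  rep : IsPhaseTypeRep π T
  reward_nonneg : ∀ k i, 0 ≤ R k i
  laplace_eq : ∀ u, laplace P u = gmmlTransform α π T R u

/-- `Q` is the law of `X^(1/ν) = (X₁^(1/ν₁), …, Xₙ^(1/νₙ))` for some `X ~ GMML(α, π, T, R)`,
where `ν > 0`. -/
def IsPowerGMML {n p : ℕ} (ν α : Fin n → ℝ) (π : Fin p → ℝ) (T : Matrix (Fin p) (Fin p) ℝ)
    (R : Matrix (Fin p) (Fin n) ℝ) (Q : ProbabilityMeasure (Fin n → ℝ≥0)) : Prop :=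
  (∀ i, 0 < ν i) ∧ ∃ P : ProbabilityMeasure (Fin n → ℝ≥0), IsGMML α π T R P ∧
    (Q : Measure (Fin n → ℝ≥0)) =
      (P : Measure (Fin n → ℝ≥0)).map fun x i => x i ^ (1 / ν i)

/-- The laws of all `GMML(α, π, T, R)` vectors in `[0, ∞)ⁿ`, of all dimensions `p`. -/
def gmmlClass (n : ℕ) : Set (ProbabilityMeasure (Fin n → ℝ≥0)) :=
  {P | ∃ (α : Fin n → ℝ) (p : ℕ) (π : Fin p → ℝ) (T : Matrix (Fin p) (Fin p) ℝ)
    (R : Matrix (Fin p) (Fin n) ℝ), IsGMML α π T R P}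

/-- The laws of all `GMML^(1/ν)(α, π, T, R)` vectors with given `ν` and `α`, of all
dimensions `p`. -/
def powerGMMLClass {n : ℕ} (ν α : Fin n → ℝ) : Set (ProbabilityMeasure (Fin n → ℝ≥0)) :=
  {Q | ∃ (p : ℕ) (π : Fin p → ℝ) (T : Matrix (Fin p) (Fin p) ℝ)
    (R : Matrix (Fin p) (Fin n) ℝ), IsPowerGMML ν α π T R Q}

end MatrixMittagLeffler

end

namespace MatrixMittagLeffler

open Filter Topology Set

/-! All three claims rest on one perturbation. Given a target law `P`, let `Y` be a simple function
approximating a vector with law `P`, and multiply it componentwise by an independent vector `Z`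
close to `(1, …, 1)`. The product is weakly close to `P`, so it suffices that it lies in the class
and that `Z` can be pushed to the vector of ones (`dense_of_concentrates`).

Take `Z = W^(1/ν)` with `W_i = (G/(m+1))^(1/α_i) S_i`, where `G` is gamma with shape `m+1` and the
`S_i` are independent positive `α_i`-stable variables. The Laplace transform of `W` is `(1 + ∑
u_i^α_i/(m+1))^(-(m+1))`. Given `Y = c`, the `ν`-th power of the product is `W` rescaled by `c^ν`,
which only changes the coefficients of `u_i^α_i`. Averaging over the finitely many values of `Y`
gives a mixture of such powers, which is the transform of parallel Erlang chains with rewards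
constant along each chain (`gmmlTransform_erlang`, `exists_mem_powerGMMLClass`).

There are two ways to force `Z → 1`. If `α → 1` and `m → ∞`, the transform of `W` tends to `exp (-∑
u_i)`, so `W → 1`, and so does `Z` as long as `1/ν` converges; this gives (i) and (iii). If `α` and
`m = 0` are fixed, `W` is almost surely positive and its high roots tend to one; this gives (ii).

The stable laws are obtained as limits of normalized Pareto sums, by tightness. -/

/-! ### Laplace transforms on the half line -/

lemma continuous_exp_neg_mul (u : ℝ≥0) :
    Continuous fun x : ℝ≥0 => Real.exp (-((u : ℝ) * x)) := by fun_prop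

lemma exp_neg_mul_le_one (u x : ℝ≥0) : Real.exp (-((u : ℝ) * x)) ≤ 1 :=
  Real.exp_le_one_iff.2 (by simp only [Left.neg_nonpos_iff]; positivity)

lemma integrable_exp_neg_mul (μ : Measure ℝ≥0) [IsFiniteMeasure μ] (u : ℝ≥0) :
    Integrable (fun x : ℝ≥0 => Real.exp (-((u : ℝ) * x))) μ :=
  Integrable.of_bound (continuous_exp_neg_mul u).aestronglyMeasurable 1
    (Eventually.of_forall fun x => by
      rw [Real.norm_of_nonneg (Real.exp_pos _).le]; exact exp_neg_mul_le_one u x)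

/-- A tail bound in terms of the Laplace transform near the origin. -/
lemma measureReal_Iic_compl_le (μ : ProbabilityMeasure ℝ≥0) {K : ℝ≥0} (hK : 0 < K) :
    (1 - Real.exp (-1)) * (μ : Measure ℝ≥0).real (Iic K)ᶜ ≤
      1 - ∫ x, Real.exp (-(((K⁻¹ : ℝ≥0) : ℝ) * x)) ∂(μ : Measure ℝ≥0) := by
  have h1 : 1 - ∫ x, Real.exp (-(((K⁻¹ : ℝ≥0) : ℝ) * x)) ∂(μ : Measure ℝ≥0) =
      ∫ x, (1 - Real.exp (-(((K⁻¹ : ℝ≥0) : ℝ) * x))) ∂(μ : Measure ℝ≥0) := by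
    rw [integral_sub (integrable_const _) (integrable_exp_neg_mul _ _)]; simp
  have hs : MeasurableSet (Iic K)ᶜ := measurableSet_Iic.compl
  rw [h1, mul_comm, ← smul_eq_mul, ← integral_indicator_const _ hs]
  refine integral_mono ((integrable_const _).indicator hs)
    ((integrable_const _).sub (integrable_exp_neg_mul _ _)) fun x => ?_
  by_cases hx : x ∈ (Iic K)ᶜ
  · simp only [indicator_of_mem hx]
    have hx' : K < x := not_le.1 hx
    gcongr
    have : (1 : ℝ) ≤ (K : ℝ)⁻¹ * x := by
      rw [inv_mul_eq_div, one_le_div (by exact_mod_cast hK)]; exact_mod_cast hx'.le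
    simpa using this
  · simp only [indicator_of_notMem hx]
    exact sub_nonneg.2 (exp_neg_mul_le_one _ _)

/-- A continuity theorem for Laplace transforms on the half line: a pointwise limit of Laplace
transforms which are equicontinuous at the origin is a Laplace transform. -/
theorem exists_laplace_eq_of_tendsto (μ : ℕ → ProbabilityMeasure ℝ≥0) {L ω : ℝ≥0 → ℝ}
    (hL : ∀ u : ℝ≥0, Tendsto (fun k => ∫ x, Real.exp (-((u : ℝ) * x)) ∂(μ k : Measure ℝ≥0)) atTop
      (𝓝 (L u)))
    (hω : Tendsto ω (𝓝 0) (𝓝 0))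
    (hb : ∀ (k : ℕ) (u : ℝ≥0), 1 - ∫ x, Real.exp (-((u : ℝ) * x)) ∂(μ k : Measure ℝ≥0) ≤ ω u) :
    ∃ σ : ProbabilityMeasure ℝ≥0, ∀ u : ℝ≥0,
      ∫ x, Real.exp (-((u : ℝ) * x)) ∂(σ : Measure ℝ≥0) = L u := by
  have hc : 0 < 1 - Real.exp (-1) := by simp
  have htight : IsTightMeasureSet {((ν : ProbabilityMeasure ℝ≥0) : Measure ℝ≥0) | ν ∈ range μ} := by
    rw [isTightMeasureSet_iff_exists_isCompact_measure_compl_le]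
    intro ε hε
    obtain ⟨δ, hδ, hδε⟩ := ENNReal.lt_iff_exists_nnreal_btwn.1 hε
    have hδ0 : (0 : ℝ) < δ := by exact_mod_cast hδ
    have hinv : Tendsto (fun K : ℝ≥0 => K⁻¹) atTop (𝓝 0) := tendsto_inv_atTop_zero
    have := ((hω.comp hinv).eventually_lt_const (mul_pos hc hδ0)).and (eventually_gt_atTop 0)
    obtain ⟨K, hK, hK0⟩ := this.exists
    refine ⟨Iic K, ?_, ?_⟩
    · rw [← Icc_bot]; exact isCompact_Icc
    · rintro _ ⟨_, ⟨k, rfl⟩, rfl⟩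
      refine le_trans ?_ hδε.le
      have h1 := (measureReal_Iic_compl_le (μ k) hK0).trans ((hb k _).trans hK.le)
      have h2 := le_of_mul_le_mul_left h1 hc
      rw [← ENNReal.ofReal_coe_nnreal]
      exact (ENNReal.le_ofReal_iff_toReal_le (measure_ne_top _ _) hδ0.le).2 h2
  have hcomp := isCompact_closure_of_isTightMeasureSet htight
  -- Only existence of a limit law is needed. A limit along a free ultrafilter suffices, since `hL`
  -- passes to it; no subsequence and no uniqueness theorem for Laplace transforms enter.
  obtain ⟨σ, -, hσ⟩ := hcomp.ultrafilter_le_nhds ((hyperfilter ℕ).map μ) (by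
    rw [le_principal_iff]
    exact mem_map.2 (Eventually.of_forall fun k => subset_closure (mem_range_self k)))
  have hσ' : Tendsto μ (hyperfilter ℕ) (𝓝 σ) := hσ
  refine ⟨σ, fun u => ?_⟩
  have h1 := ProbabilityMeasure.tendsto_iff_forall_integral_tendsto.1 hσ'
    (BoundedContinuousFunction.ofNormedAddCommGroup _ (continuous_exp_neg_mul u) 1 (fun x => by
      rw [Real.norm_of_nonneg (Real.exp_pos _).le]; exact exp_neg_mul_le_one u x))
  exact tendsto_nhds_unique h1 ((hL u).mono_left Nat.hyperfilter_le_atTop)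

/-! ### Positive stable laws as limits of Pareto sums -/

/-- The integrand is at most `1` near the origin and, by `1 - exp (-y) ≤ y`, at most `s^(-β)` at
infinity. -/
lemma integrableOn_one_sub_exp_neg_rpow {β : ℝ} (hβ : 1 < β) :
    IntegrableOn (fun s : ℝ => 1 - Real.exp (-s ^ (-β))) (Ioi 0) := by
  have hm : Measurable fun s : ℝ => 1 - Real.exp (-s ^ (-β)) := by fun_prop
  rw [← Ioc_union_Ioi_eq_Ioi zero_le_one]
  refine IntegrableOn.union ?_ ?_
  · refine Measure.integrableOn_of_bounded (M := 1) (by simp) hm.aestronglyMeasurable ?_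
    filter_upwards [ae_restrict_mem measurableSet_Ioc] with s hs
    have := Real.rpow_nonneg hs.1.le (-β)
    have h1 : Real.exp (-s ^ (-β)) ≤ 1 := Real.exp_le_one_iff.2 (by linarith)
    rw [Real.norm_of_nonneg (by linarith)]
    linarith [Real.exp_pos (-s ^ (-β))]
  · refine Integrable.mono' (integrableOn_Ioi_rpow_of_lt (a := -β) (by linarith) zero_lt_one)
      hm.aestronglyMeasurable ?_
    filter_upwards [ae_restrict_mem measurableSet_Ioi] with s hs
    have hs0 : (0 : ℝ) < s := zero_lt_one.trans hs
    have := Real.rpow_nonneg hs0.le (-β)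
    have h1 : Real.exp (-s ^ (-β)) ≤ 1 := Real.exp_le_one_iff.2 (by linarith)
    rw [Real.norm_of_nonneg (by linarith)]
    linarith [Real.add_one_le_exp (-s ^ (-β))]

lemma one_sub_exp_neg_rpow_pos {β s : ℝ} (hs : 0 < s) : 0 < 1 - Real.exp (-s ^ (-β)) := by
  have := Real.rpow_pos_of_pos hs (-β)
  simpa using this

lemma integral_one_sub_exp_neg_rpow_pos {β : ℝ} (hβ : 1 < β) :
    0 < ∫ s in Ioi (0 : ℝ), (1 - Real.exp (-s ^ (-β))) := by
  rw [setIntegral_pos_iff_support_of_nonneg_ae]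
  · have : Ioi (0 : ℝ) ⊆ (Function.support fun s : ℝ => 1 - Real.exp (-s ^ (-β))) ∩ Ioi 0 :=
      fun s hs => ⟨(one_sub_exp_neg_rpow_pos hs).ne', hs⟩
    exact lt_of_lt_of_le (by simp) (measure_mono this)
  · filter_upwards [ae_restrict_mem measurableSet_Ioi] with s hs
    exact (one_sub_exp_neg_rpow_pos hs).le
  · exact integrableOn_one_sub_exp_neg_rpow hβ

/-- The Laplace transform of the law of `n ^ (-β)` times the sum of `n` independent Pareto variables
with index `1 / β`. -/
lemma exists_laplace_eq_pareto_sum {β : ℝ} (hβ : 1 < β) {n : ℕ} (hn : 0 < n) :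
    ∃ μ : ProbabilityMeasure ℝ≥0, ∀ u : ℝ≥0, 0 < u →
      ∫ x, Real.exp (-((u : ℝ) * x)) ∂(μ : Measure ℝ≥0) =
        (1 + -((u : ℝ) ^ β⁻¹ * (n : ℝ)⁻¹ *
          ∫ s in (0 : ℝ)..n * (u : ℝ) ^ (-β⁻¹), (1 - Real.exp (-s ^ (-β))))) ^ n := by
  have hn' : (0 : ℝ) < n := by exact_mod_cast hn
  let P : Measure ℝ := volume.restrict (Ioc 0 1)
  have : IsProbabilityMeasure P := ⟨by simp [P]⟩
  -- For `x` uniform on `(0, 1]`, the variable `x^(-β)` is Pareto with index `1/β`.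
  let F : (Fin n → ℝ) → ℝ≥0 := fun x => ∑ i, ((n * x i).toNNReal) ^ (-β)
  have hF : Measurable F := by fun_prop
  refine ⟨⟨(Measure.pi fun _ : Fin n => P).map F, Measure.isProbabilityMeasure_map hF.aemeasurable⟩,
    fun u hu => ?_⟩
  have hu' : (0 : ℝ) < u := by exact_mod_cast hu
  rw [ProbabilityMeasure.coe_mk, integral_map hF.aemeasurable
    (continuous_exp_neg_mul u).aestronglyMeasurable]
  have h1 : ∀ x : Fin n → ℝ, Real.exp (-((u : ℝ) * F x)) =
      ∏ i, Real.exp (-((u : ℝ) * (((n * x i).toNNReal ^ (-β) : ℝ≥0) : ℝ))) := fun x => by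
    rw [← Real.exp_sum]
    simp only [F, NNReal.coe_sum, Finset.mul_sum, Finset.sum_neg_distrib]
  simp_rw [h1]
  rw [integral_fintype_prod_eq_pow
    (fun x : ℝ => Real.exp (-((u : ℝ) * (((n * x).toNNReal ^ (-β) : ℝ≥0) : ℝ)))), Fintype.card_fin]
  congr 1
  -- Chosen so that `u (n x)^(-β) = (c x)^(-β)`; substituting `s = c x` then isolates the dependence
  -- on `u`.
  set c : ℝ := n * (u : ℝ) ^ (-β⁻¹) with hc
  have hc0 : 0 < c := by positivity
  have h2 : ∫ x, Real.exp (-((u : ℝ) * (((n * x).toNNReal ^ (-β) : ℝ≥0) : ℝ))) ∂P =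
      ∫ x in (0 : ℝ)..1, (1 - (1 - Real.exp (-(c * x) ^ (-β)))) := by
    rw [intervalIntegral.integral_of_le zero_le_one]
    refine setIntegral_congr_fun measurableSet_Ioc fun x hx => ?_
    have hx0 : 0 < x := hx.1
    have : (u : ℝ) * (n * x) ^ (-β) = (c * x) ^ (-β) := by
      rw [hc, mul_assoc, mul_left_comm, Real.mul_rpow (x := (u : ℝ) ^ (-β⁻¹)) (by positivity)
        (by positivity), ← Real.rpow_mul hu'.le]
      congr 1
      rw [neg_mul_neg, inv_mul_cancel₀ (by positivity), Real.rpow_one]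
    simp only [NNReal.coe_rpow, Real.coe_toNNReal _ (by positivity : (0 : ℝ) ≤ n * x), this]
    ring
  have hint : IntervalIntegrable (fun s : ℝ => 1 - Real.exp (-s ^ (-β))) volume 0 c := by
    rw [intervalIntegrable_iff_integrableOn_Ioc_of_le hc0.le]
    exact (integrableOn_one_sub_exp_neg_rpow hβ).mono_set Ioc_subset_Ioi_self
  have hint' : IntervalIntegrable (fun x : ℝ => 1 - Real.exp (-(c * x) ^ (-β))) volume 0 1 := by
    have := hint.comp_mul_left (c := c)
    simpa [hc0.ne'] using this
  rw [h2, intervalIntegral.integral_sub (by simp) hint',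
    intervalIntegral.integral_comp_mul_left (fun s => 1 - Real.exp (-s ^ (-β))) hc0.ne']
  simp only [intervalIntegral.integral_const, sub_zero, mul_zero, mul_one, smul_eq_mul]
  rw [sub_eq_add_neg]
  congr 3
  rw [hc, mul_inv, Real.rpow_neg hu'.le, inv_inv, mul_comm]

/-- The positive stable laws, up to a scale factor. -/
lemma exists_laplace_eq_exp_neg_const_mul_rpow {α : ℝ} (h0 : 0 < α) (h1 : α < 1) :
    ∃ C : ℝ, 0 < C ∧ ∃ σ : ProbabilityMeasure ℝ≥0, ∀ u : ℝ≥0,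
      ∫ x, Real.exp (-((u : ℝ) * x)) ∂(σ : Measure ℝ≥0) = Real.exp (-((u : ℝ) ^ α * C)) := by
  obtain ⟨β, hβ⟩ : ∃ β, β = α⁻¹ := ⟨_, rfl⟩
  have hβ1 : 1 < β := hβ ▸ (one_lt_inv₀ h0).2 h1
  have hαβ : α = β⁻¹ := by rw [hβ, inv_inv]
  set g : ℝ → ℝ := fun s => 1 - Real.exp (-s ^ (-β)) with hg
  set C := ∫ s in Ioi (0 : ℝ), g s with hC
  have hgi : IntegrableOn g (Ioi 0) := integrableOn_one_sub_exp_neg_rpow hβ1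
  have hC0 : 0 < C := integral_one_sub_exp_neg_rpow_pos hβ1
  have hg0 : ∀ c, 0 ≤ c → 0 ≤ ∫ s in (0 : ℝ)..c, g s := fun c hc => by
    rw [intervalIntegral.integral_of_le hc]
    exact setIntegral_nonneg measurableSet_Ioc fun s hs => (one_sub_exp_neg_rpow_pos hs.1).le
  have hgC : ∀ c, 0 ≤ c → ∫ s in (0 : ℝ)..c, g s ≤ C := fun c hc => by
    rw [intervalIntegral.integral_of_le hc]
    refine setIntegral_mono_set hgi ?_ Ioc_subset_Ioi_self.eventuallyLE
    filter_upwards [ae_restrict_mem measurableSet_Ioi] with s hs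
    exact (one_sub_exp_neg_rpow_pos hs).le
  choose μ hμ using fun k : ℕ => exists_laplace_eq_pareto_sum hβ1 k.succ_pos
  refine ⟨C, hC0, exists_laplace_eq_of_tendsto μ (ω := fun u => (u : ℝ) ^ α * C) ?_ ?_ ?_⟩
  · intro u
    rcases eq_zero_or_pos u with rfl | hu
    · simp [Real.zero_rpow h0.ne']
    have hu' : (0 : ℝ) < u := by exact_mod_cast hu
    simp_rw [hμ _ u hu]
    have key : Tendsto (fun n : ℕ => (1 + -((u : ℝ) ^ β⁻¹ * (n : ℝ)⁻¹ *
          ∫ s in (0 : ℝ)..n * (u : ℝ) ^ (-β⁻¹), g s)) ^ n) atTop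
          (𝓝 (Real.exp (-((u : ℝ) ^ α * C)))) := by
      refine Real.tendsto_one_add_pow_exp_of_tendsto ?_
      have hlim : Tendsto (fun n : ℕ => ∫ s in (0 : ℝ)..n * (u : ℝ) ^ (-β⁻¹), g s) atTop (𝓝 C) :=
        intervalIntegral_tendsto_integral_Ioi 0 hgi
          (tendsto_natCast_atTop_atTop.atTop_mul_const (by positivity))
      refine ((hlim.const_mul ((u : ℝ) ^ α)).neg).congr' ?_
      filter_upwards [eventually_gt_atTop 0] with n hn
      have hn' : (0 : ℝ) < n := by exact_mod_cast hn
      rw [hαβ]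
      field_simp
    exact key.comp (tendsto_add_atTop_nat 1)
  · have : Continuous fun u : ℝ≥0 => (u : ℝ) ^ α * C :=
      (NNReal.continuous_coe.rpow_const fun _ => Or.inr h0.le).mul continuous_const
    simpa [Real.zero_rpow h0.ne'] using this.tendsto 0
  · intro k u
    rcases eq_zero_or_pos u with rfl | hu
    · simp [Real.zero_rpow h0.ne']
    have hu' : (0 : ℝ) < u := by exact_mod_cast hu
    rw [hμ k u hu]
    have hk : (0 : ℝ) < (k.succ : ℕ) := by positivity
    set I := ∫ s in (0 : ℝ)..(k.succ : ℕ) * (u : ℝ) ^ (-β⁻¹), (1 - Real.exp (-s ^ (-β))) with hI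
    have hIC : I ≤ C := hgC _ (by positivity)
    have hI0 : 0 ≤ I := hg0 _ (by positivity)
    -- The integrand is at most one. This keeps the base of the power non-negative, so that
    -- Bernoulli's inequality yields the bound `u^α C` uniformly in `k`.
    have hIc : I ≤ (k.succ : ℕ) * (u : ℝ) ^ (-β⁻¹) := by
      rw [hI, intervalIntegral.integral_of_le (by positivity)]
      refine (setIntegral_mono_on (hgi.mono_set Ioc_subset_Ioi_self)
        (integrableOn_const (C := (1 : ℝ)) (by simp)) measurableSet_Ioc fun s hs => ?_).trans ?_
      · exact sub_le_self _ (Real.exp_pos _).le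
      · rw [setIntegral_const, Real.volume_real_Ioc_of_le (by positivity)]; simp
    have ha : (u : ℝ) ^ β⁻¹ * ((k.succ : ℕ) : ℝ)⁻¹ * I ≤ 1 := by
      calc _ ≤ (u : ℝ) ^ β⁻¹ * ((k.succ : ℕ) : ℝ)⁻¹ * ((k.succ : ℕ) * (u : ℝ) ^ (-β⁻¹)) := by gcongr
        _ = 1 := by rw [Real.rpow_neg hu'.le]; field_simp
    have hbern := one_add_mul_le_pow (a := -((u : ℝ) ^ β⁻¹ * ((k.succ : ℕ) : ℝ)⁻¹ * I))
      (by linarith) k.succ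
    have : ((k.succ : ℕ) : ℝ) * -((u : ℝ) ^ β⁻¹ * ((k.succ : ℕ) : ℝ)⁻¹ * I) =
        -((u : ℝ) ^ α * I) := by
      rw [hαβ]; field_simp
    have h3 : (u : ℝ) ^ α * I ≤ (u : ℝ) ^ α * C := by gcongr
    linarith

/-- The positive stable laws: for `0 < α ≤ 1` the function `u ↦ exp (-u ^ α)` is the Laplace
transform of a probability measure on the half line. -/
theorem exists_stable {α : ℝ} (h0 : 0 < α) (h1 : α ≤ 1) :
    ∃ σ : ProbabilityMeasure ℝ≥0, ∀ u : ℝ≥0,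
      ∫ x, Real.exp (-((u : ℝ) * x)) ∂(σ : Measure ℝ≥0) = Real.exp (-(u : ℝ) ^ α) := by
  rcases h1.eq_or_lt with rfl | h1
  · exact ⟨⟨Measure.dirac 1, inferInstance⟩, fun u => by simp⟩
  obtain ⟨C, hC, σ, hσ⟩ := exists_laplace_eq_exp_neg_const_mul_rpow h0 h1
  -- Scaling the variable by `c` multiplies the exponent by `c^α = C⁻¹`.
  let c : ℝ≥0 := C.toNNReal ^ (-α⁻¹)
  have hm : Measurable fun x : ℝ≥0 => c * x := by fun_prop
  refine ⟨σ.map hm.aemeasurable, fun u => ?_⟩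
  rw [ProbabilityMeasure.toMeasure_map, integral_map hm.aemeasurable
    (continuous_exp_neg_mul u).aestronglyMeasurable]
  have := hσ (u * c)
  simp only [NNReal.coe_mul, ← mul_assoc] at this ⊢
  rw [this, Real.mul_rpow u.coe_nonneg c.coe_nonneg]
  have : (c : ℝ) ^ α = C⁻¹ := by
    rw [NNReal.coe_rpow, Real.coe_toNNReal _ hC.le, ← Real.rpow_mul hC.le, neg_mul,
      inv_mul_cancel₀ h0.ne', Real.rpow_neg_one]
  rw [this]
  field_simp

/-! ### Parallel Erlang chains and their transform -/

/-- The sub-intensity matrix of `N` parallel chains of `m` states, all passed through at unit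
rate. -/
def erlangMatrix (N m : ℕ) : Matrix (Fin N × Fin m) (Fin N × Fin m) ℝ :=
  Matrix.of fun a b => if a = b then -1 else if a.1 = b.1 ∧ (a.2 : ℕ) + 1 = b.2 then 1 else 0

lemma erlangMatrix_mulVec {N m : ℕ} (v : Fin N × Fin m → ℝ) (a : Fin N × Fin m) :
    (erlangMatrix N m *ᵥ v) a =
      -v a + if h : (a.2 : ℕ) + 1 < m then v (a.1, ⟨a.2 + 1, h⟩) else 0 := by
  have h1 : ∀ b, erlangMatrix N m a b * v b = (if a = b then -v b else 0) +
      (if a.1 = b.1 ∧ (a.2 : ℕ) + 1 = b.2 then v b else 0) := fun b => by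
    by_cases hab : a = b
    · subst hab; simp [erlangMatrix]
    · simp [erlangMatrix, hab]
  simp only [Matrix.mulVec, dotProduct, h1, Finset.sum_add_distrib, Finset.sum_ite_eq,
    Finset.mem_univ, if_true]
  congr 1
  split_ifs with h
  · rw [Finset.sum_eq_single (a.1, ⟨a.2 + 1, h⟩)]
    · simp
    · rintro ⟨b1, b2⟩ - hb
      refine if_neg fun hh => hb ?_
      ext
      · simp [hh.1]
      · simp [hh.2]
    · simp
  · refine Finset.sum_eq_zero fun b _ => if_neg fun hh => h ?_
    rw [hh.2]; exact b.2.2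

/-- The initial distribution that starts the parallel Erlang chains with weights `w`, each in its
first state. -/
def erlangInit {N : ℕ} (m : ℕ) (w : Fin N → ℝ) (k : Fin (N * (m + 1))) : ℝ :=
  if (finProdFinEquiv.symm k).2 = 0 then w (finProdFinEquiv.symm k).1 else 0

/-- The sub-intensity matrix of the parallel Erlang chains on a linearly ordered state space. -/
def erlangRate (N m : ℕ) : Matrix (Fin (N * (m + 1))) (Fin (N * (m + 1))) ℝ :=
  (erlangMatrix N (m + 1)).submatrix finProdFinEquiv.symm finProdFinEquiv.symm

lemma exitRate_erlangRate {N m : ℕ} (k : Fin (N * (m + 1))) :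
    exitRate (erlangRate N m) k =
      if (((finProdFinEquiv.symm k).2 : Fin (m + 1)) : ℕ) < m then 0 else 1 := by
  have : (erlangRate N m *ᵥ 1) k =
      (erlangMatrix N (m + 1) *ᵥ 1) (finProdFinEquiv.symm k) := by
    rw [erlangRate, Matrix.submatrix_mulVec_equiv]; rfl
  rw [exitRate, Pi.neg_apply, this, erlangMatrix_mulVec]
  generalize finProdFinEquiv.symm k = a
  split_ifs <;> first | omega | simp

lemma sum_erlangInit_mul {N : ℕ} (m : ℕ) (w : Fin N → ℝ) (h : Fin N × Fin (m + 1) → ℝ) :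
    ∑ k, erlangInit m w k * h (finProdFinEquiv.symm k) = ∑ j, w j * h (j, 0) := by
  rw [← finProdFinEquiv.sum_comp]
  simp [erlangInit, Fintype.sum_prod_type]

lemma isPhaseTypeRep_erlang {N : ℕ} (m : ℕ) {w : Fin N → ℝ} (hw : ∀ j, 0 ≤ w j)
    (hw1 : ∑ j, w j = 1) : IsPhaseTypeRep (erlangInit m w) (erlangRate N m) where
  init_nonneg k := by unfold erlangInit; split_ifs <;> simp [hw]
  init_sum := by simpa [hw1] using sum_erlangInit_mul m w 1
  rate_nonneg k l hkl := by
    have : finProdFinEquiv.symm k ≠ (finProdFinEquiv.symm l : Fin N × Fin (m + 1)) :=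
      fun h => hkl (finProdFinEquiv.symm.injective h)
    simp only [erlangRate, erlangMatrix, Matrix.submatrix_apply, Matrix.of_apply, if_neg this]
    split_ifs <;> simp
  exit_nonneg k := by rw [exitRate_erlangRate]; split_ifs <;> simp
  transient := by
    -- Induction on the distance `d` to the last state of the chain, the only one with positive exit
    -- rate.
    suffices h : ∀ d (j : Fin N) (l : Fin (m + 1)), m - (l : ℕ) = d →
        Relation.ReflTransGen (fun a b => a ≠ b ∧ 0 < erlangRate N m a b)
          (finProdFinEquiv (j, l)) (finProdFinEquiv (j, Fin.last m)) by
      intro k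
      obtain ⟨⟨j, l⟩, rfl⟩ := finProdFinEquiv.surjective k
      exact ⟨finProdFinEquiv (j, Fin.last m), h _ j l rfl, by simp [exitRate_erlangRate]⟩
    intro d
    induction d with
    | zero =>
      intro j l hl
      have : l = Fin.last m := by ext; simp; omega
      rw [this]
    | succ d ih =>
      intro j l hl
      have hlt : (l : ℕ) + 1 < m + 1 := by omega
      have hne : (j, l) ≠ (j, (⟨l + 1, hlt⟩ : Fin (m + 1))) := by
        simp [Fin.ext_iff]
      refine Relation.ReflTransGen.head ⟨fun h => hne (finProdFinEquiv.injective h), ?_⟩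
        (ih j ⟨l + 1, hlt⟩ (by simp only; omega))
      simp [erlangRate, erlangMatrix, hne]

/-- The transform of the phase-type representation by parallel Erlang chains, with rewards that are
constant along each chain. -/
theorem gmmlTransform_erlang {n N : ℕ} (m : ℕ) (α : Fin n → ℝ) (w : Fin N → ℝ)
    {r : Fin N → Fin n → ℝ} (hr : ∀ j i, 0 ≤ r j i) (u : Fin n → ℝ≥0) :
    gmmlTransform α (erlangInit m w) (erlangRate N m)
        (Matrix.of fun k => r (finProdFinEquiv.symm k : Fin N × Fin (m + 1)).1) u =
      ∑ j, w j * (1 + ∑ i, r j i * (u i : ℝ) ^ α i)⁻¹ ^ (m + 1) := by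
  set s : Fin N → ℝ := fun j => ∑ i, r j i * (u i : ℝ) ^ α i with hs
  have hs0 : ∀ j, 0 < 1 + s j := fun j => by
    have : 0 ≤ s j := Finset.sum_nonneg fun i _ => mul_nonneg (hr j i) (by positivity)
    linarith
  set A : Matrix (Fin N × Fin (m + 1)) (Fin N × Fin (m + 1)) ℝ :=
    Matrix.diagonal (fun a => s a.1) - erlangMatrix N (m + 1) with hA
  have hAv : ∀ (v : Fin N × Fin (m + 1) → ℝ) a, (A *ᵥ v) a = (1 + s a.1) * v a -
      if h : (a.2 : ℕ) + 1 < m + 1 then v (a.1, ⟨a.2 + 1, h⟩) else 0 := fun v a => by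
    rw [hA, Matrix.sub_mulVec, Pi.sub_apply, Matrix.mulVec_diagonal, erlangMatrix_mulVec]
    ring
  -- Back substitution: `A` is bidiagonal on each chain with diagonal `1 + s j > 0`, so a kernel
  -- vector vanishes from the last state backwards.
  have hAinj : Function.Injective A.mulVec := by
    rw [← Matrix.coe_mulVecLin, ← LinearMap.ker_eq_bot, LinearMap.ker_eq_bot']
    intro v hv
    have hv' : ∀ a, (A *ᵥ v) a = 0 := fun a => congrFun hv a
    suffices h : ∀ d (j : Fin N) (l : Fin (m + 1)), m - (l : ℕ) = d → v (j, l) = 0 by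
      ext ⟨j, l⟩; exact h _ j l rfl
    intro d
    induction d with
    | zero =>
      intro j l hl
      have := hv' (j, l)
      rw [hAv, dif_neg (by simp only; omega), sub_zero] at this
      exact (mul_eq_zero.1 this).resolve_left (hs0 j).ne'
    | succ d ih =>
      intro j l hl
      have := hv' (j, l)
      rw [hAv, dif_pos (by simp only; omega), ih j ⟨l + 1, _⟩ (by simp only; omega), sub_zero] at this
      exact (mul_eq_zero.1 this).resolve_left (hs0 j).ne'
  have hAu : IsUnit A.det :=
    (Matrix.isUnit_iff_isUnit_det A).1 (Matrix.mulVec_injective_iff_isUnit.1 hAinj)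
  -- One factor `(1 + s)⁻¹` for each state still to be passed through. This vector solves `A h = t`,
  -- so the inverse need not be computed.
  let h : Fin N × Fin (m + 1) → ℝ := fun a => (1 + s a.1)⁻¹ ^ (m + 1 - (a.2 : ℕ))
  have hAh : ∀ a, (A *ᵥ h) a = if (a.2 : ℕ) < m then 0 else 1 := by
    intro a
    have ha := a.2.2
    rw [hAv]
    have hne := (hs0 a.1).ne'
    split_ifs with h1 h2 h2
    · have : m + 1 - (a.2 : ℕ) = (m + 1 - (a.2 + 1)) + 1 := by omega
      simp only [h]
      rw [this, pow_succ]
      field_simp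
      simp
    · omega
    · omega
    · have : m + 1 - (a.2 : ℕ) = 1 := by omega
      simp only [h, this, pow_one, sub_zero, mul_inv_cancel₀ hne]
  have hD : Matrix.diagonal ((Matrix.of fun k => r (finProdFinEquiv.symm k : Fin N × Fin (m + 1)).1)
      *ᵥ fun i => (u i : ℝ) ^ α i) - erlangRate N m =
      A.submatrix finProdFinEquiv.symm finProdFinEquiv.symm := by
    rw [hA, Matrix.submatrix_sub, Pi.sub_apply, Pi.sub_apply, Matrix.submatrix_diagonal_equiv]
    rfl
  have hE : exitRate (erlangRate N m) = (A *ᵥ h) ∘ finProdFinEquiv.symm := by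
    ext k; rw [exitRate_erlangRate, Function.comp_apply, hAh]
  rw [gmmlTransform, hD, hE, Matrix.inv_submatrix_equiv, Matrix.submatrix_mulVec_equiv,
    Function.comp_assoc, Equiv.symm_symm, Equiv.symm_comp_self, Function.comp_id,
    Matrix.mulVec_mulVec, Matrix.nonsing_inv_mul A hAu, Matrix.one_mulVec, dotProduct]
  simp only [Function.comp_apply]
  rw [sum_erlangInit_mul]
  simp [h, hs]

/-! ### Gamma-subordinated stable vectors -/

lemma measurable_gammaPDF (a r : ℝ) : Measurable (ProbabilityTheory.gammaPDF a r) :=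
  (ProbabilityTheory.measurable_gammaPDFReal a r).ennreal_ofReal

lemma integral_exp_neg_mul_gammaMeasure (m : ℕ) {s : ℝ} (hs : 0 ≤ s) :
    ∫ x, Real.exp (-(s * x)) ∂ProbabilityTheory.gammaMeasure (m + 1) 1 = (1 + s)⁻¹ ^ (m + 1) := by
  have hm : (0 : ℝ) < m + 1 := by positivity
  have h1 : ∫ x, Real.exp (-(s * x)) ∂ProbabilityTheory.gammaMeasure (m + 1) 1 =
      ∫ x, ProbabilityTheory.gammaPDFReal (m + 1) 1 x * Real.exp (-(s * x)) := by
    rw [ProbabilityTheory.gammaMeasure, integral_withDensity_eq_integral_toReal_smul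
      (measurable_gammaPDF _ _)
      (Eventually.of_forall fun _ => ENNReal.ofReal_lt_top)]
    refine integral_congr_ae (Eventually.of_forall fun x => ?_)
    simp only [ProbabilityTheory.gammaPDF, smul_eq_mul]
    rw [ENNReal.toReal_ofReal (ProbabilityTheory.gammaPDFReal_nonneg hm one_pos x)]
  have h2 : ∀ᵐ x : ℝ, ProbabilityTheory.gammaPDFReal (m + 1) 1 x * Real.exp (-(s * x)) =
      (Ioi (0 : ℝ)).indicator (fun x => (Real.Gamma (m + 1))⁻¹ *
        (x ^ ((m : ℝ) + 1 - 1) * Real.exp (-((1 + s) * x)))) x := by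
    filter_upwards [compl_mem_ae_iff.2 (measure_singleton (0 : ℝ))] with x hx
    have hx : x ≠ 0 := hx
    rcases hx.lt_or_gt with h | h
    · simp [ProbabilityTheory.gammaPDFReal, h.not_ge, h.le]
    · rw [indicator_of_mem (mem_Ioi.2 h), ProbabilityTheory.gammaPDFReal, if_pos h.le,
        Real.one_rpow, one_div, mul_assoc, mul_assoc, ← Real.exp_add]
      congr 4
      ring
  rw [h1, integral_congr_ae h2, integral_indicator measurableSet_Ioi, integral_const_mul,
    Real.integral_rpow_mul_exp_neg_mul_Ioi hm (by linarith), ← mul_assoc, mul_comm _⁻¹, mul_assoc,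
    inv_mul_cancel₀ (Real.Gamma_pos_of_pos hm).ne', mul_one, one_div]
  exact_mod_cast Real.rpow_natCast _ (m + 1)

/-- The gamma law with integer shape, on the half line. -/
lemma exists_gamma (m : ℕ) : ∃ σ : ProbabilityMeasure ℝ≥0, ∀ s : ℝ, 0 ≤ s →
    ∫ x, Real.exp (-(s * (x : ℝ))) ∂(σ : Measure ℝ≥0) = (1 + s)⁻¹ ^ (m + 1) := by
  have hm : (0 : ℝ) < m + 1 := by positivity
  have := ProbabilityTheory.isProbabilityMeasure_gammaMeasure hm one_pos
  refine ⟨⟨(ProbabilityTheory.gammaMeasure (m + 1) 1).map Real.toNNReal,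
    Measure.isProbabilityMeasure_map measurable_real_toNNReal.aemeasurable⟩, fun s hs => ?_⟩
  rw [ProbabilityMeasure.coe_mk, integral_map measurable_real_toNNReal.aemeasurable
    (by fun_prop), ← integral_exp_neg_mul_gammaMeasure m hs]
  refine integral_congr_ae ?_
  have h0 : ∀ᵐ x ∂ProbabilityTheory.gammaMeasure (m + 1) 1, 0 ≤ x := by
    rw [ProbabilityTheory.gammaMeasure, ae_withDensity_iff
      (measurable_gammaPDF _ _)]
    exact Eventually.of_forall fun x hx => by
      by_contra h
      exact hx (ProbabilityTheory.gammaPDF_of_neg (not_le.1 h))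
  filter_upwards [h0] with x hx
  simp [hx]

lemma continuous_exp_neg_sum {n : ℕ} (u : Fin n → ℝ≥0) :
    Continuous fun x : Fin n → ℝ≥0 => Real.exp (-∑ i, (u i : ℝ) * (x i : ℝ)) := by fun_prop

lemma norm_exp_neg_sum_le_one {n : ℕ} (u x : Fin n → ℝ≥0) :
    ‖Real.exp (-∑ i, (u i : ℝ) * (x i : ℝ))‖ ≤ 1 := by
  rw [Real.norm_of_nonneg (Real.exp_pos _).le, Real.exp_le_one_iff, neg_nonpos]
  positivity

/-- A random vector whose components are independent stable variables with a common Erlang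
subordination. -/
theorem exists_laplace_eq_inv_pow {n : ℕ} {α : Fin n → ℝ} (hα : ∀ i, 0 < α i)
    (hα1 : ∀ i, α i ≤ 1) (m : ℕ) :
    ∃ M : ProbabilityMeasure (Fin n → ℝ≥0), ∀ u, laplace M u =
      (1 + ∑ i, (m + 1 : ℝ)⁻¹ * (u i : ℝ) ^ α i)⁻¹ ^ (m + 1) := by
  choose σ hσ using fun i => exists_stable (hα i) (hα1 i)
  obtain ⟨γ, hγ⟩ := exists_gamma m
  -- The power `1/α_i` makes the conditional Laplace exponent linear in the gamma variable shared by
  -- all coordinates; the factor `(m+1)⁻¹` gives that variable mean one.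
  let F : ℝ≥0 × (Fin n → ℝ≥0) → Fin n → ℝ≥0 := fun z i =>
    (((m + 1 : ℝ≥0))⁻¹ * z.1) ^ (α i)⁻¹ * z.2 i
  have hF : Measurable F := by fun_prop
  refine ⟨⟨((γ : Measure ℝ≥0).prod (Measure.pi fun i => (σ i : Measure ℝ≥0))).map F,
    Measure.isProbabilityMeasure_map hF.aemeasurable⟩, fun u => ?_⟩
  have hint : Integrable (fun z => Real.exp (-∑ i, (u i : ℝ) * (F z i : ℝ)))
      ((γ : Measure ℝ≥0).prod (Measure.pi fun i => (σ i : Measure ℝ≥0))) :=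
    Integrable.of_bound ((continuous_exp_neg_sum u).measurable.comp hF).aestronglyMeasurable 1
      (Eventually.of_forall fun z => norm_exp_neg_sum_le_one u (F z))
  unfold laplace
  rw [ProbabilityMeasure.coe_mk, integral_map hF.aemeasurable
    (continuous_exp_neg_sum u).aestronglyMeasurable, integral_prod _ hint,
    ← hγ _ (Finset.sum_nonneg fun i _ => by positivity)]
  congr 1 with g
  have h1 : ∀ x : Fin n → ℝ≥0, Real.exp (-∑ i, (u i : ℝ) * (F (g, x) i : ℝ)) =
      ∏ i, Real.exp (-(((u i * ((m + 1 : ℝ≥0)⁻¹ * g) ^ (α i)⁻¹ : ℝ≥0) : ℝ) * (x i : ℝ))) :=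
    fun x => by
      rw [← Real.exp_sum, Finset.sum_neg_distrib]
      simp only [F, NNReal.coe_mul, mul_assoc]
  simp_rw [h1]
  rw [integral_fintype_prod_eq_prod (fun i (x : ℝ≥0) =>
    Real.exp (-(((u i * ((m + 1 : ℝ≥0)⁻¹ * g) ^ (α i)⁻¹ : ℝ≥0) : ℝ) * (x : ℝ))))]
  simp_rw [hσ, ← NNReal.coe_rpow, NNReal.mul_rpow (x := u _), ← NNReal.rpow_mul]
  rw [← Real.exp_sum, Finset.sum_neg_distrib, Finset.sum_mul]
  congr 2
  refine Finset.sum_congr rfl fun i _ => ?_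
  rw [inv_mul_cancel₀ (hα i).ne', NNReal.rpow_one]
  push_cast
  ring

/-! ### Concentration at a point -/

/-- The measures `μ k` concentrate at the point `a` as `k → ∞`. -/
def Concentrates {Z : Type*} [TopologicalSpace Z] [MeasurableSpace Z] (μ : ℕ → Measure Z)
    (a : Z) : Prop :=
  ∀ U ∈ 𝓝 a, Tendsto (fun k => μ k Uᶜ) atTop (𝓝 0)

section Concentration

variable {Z : Type*} [TopologicalSpace Z] [MeasurableSpace Z] {μ : ℕ → Measure Z} {a : Z}

/-- Near `a` the integrand is within `ε/2` of `b`; elsewhere it is bounded and the mass vanishes.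
The joint limit in `(k, z)` lets the integrand vary with `k`. -/
lemma Concentrates.tendsto_integral [OpensMeasurableSpace Z] [∀ k, IsProbabilityMeasure (μ k)]
    (hμ : Concentrates μ a) {φ : ℕ → Z → ℝ} (hφ : ∀ k, Measurable (φ k)) {B : ℝ}
    (hB : ∀ k z, ‖φ k z‖ ≤ B) {b : ℝ}
    (h : Tendsto (fun p : ℕ × Z => φ p.1 p.2) (atTop ×ˢ 𝓝 a) (𝓝 b)) :
    Tendsto (fun k => ∫ z, φ k z ∂μ k) atTop (𝓝 b) := by
  rw [tendsto_iff_norm_sub_tendsto_zero]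
  refine squeeze_zero_norm' (a := fun k => ∫ z, ‖φ k z - b‖ ∂μ k) ?_ ?_
  · refine Eventually.of_forall fun k => ?_
    have hi : Integrable (φ k) (μ k) :=
      Integrable.of_bound (hφ k).aestronglyMeasurable B (Eventually.of_forall (hB k))
    have : ∫ z, φ k z ∂μ k - b = ∫ z, (φ k z - b) ∂μ k := by
      rw [integral_sub hi (integrable_const _)]; simp
    rw [norm_norm, this]
    exact norm_integral_le_integral_norm _
  · rw [Metric.tendsto_nhds]
    intro ε hε
    have hev := (Metric.tendsto_nhds.1 h) (ε / 2) (half_pos hε)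
    obtain ⟨p, hp, q, hq, hpq⟩ := eventually_prod_iff.1 hev
    obtain ⟨U, hU, hUo, haU⟩ := mem_nhds_iff.1 hq
    have h0 : Tendsto (fun k => (B + ‖b‖) * (μ k).real Uᶜ) atTop (𝓝 0) := by
      have := (ENNReal.tendsto_toReal ENNReal.zero_ne_top).comp (hμ U (hUo.mem_nhds haU))
      simpa using! this.const_mul (B + ‖b‖)
    filter_upwards [hp, h0.eventually_lt_const (half_pos hε)] with k hk hk2
    have hm : MeasurableSet Uᶜ := hUo.measurableSet.compl
    have hnn : 0 ≤ ∫ z, ‖φ k z - b‖ ∂μ k := integral_nonneg fun _ => norm_nonneg _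
    rw [dist_zero_right, Real.norm_of_nonneg hnn]
    have hbd : ∀ z, ‖φ k z - b‖ ≤ ε / 2 + Uᶜ.indicator (fun _ => B + ‖b‖) z := fun z => by
      by_cases hz : z ∈ U
      · rw [indicator_of_notMem (by simpa using hz), add_zero, ← dist_eq_norm]
        exact (hpq hk (hU hz)).le
      · rw [indicator_of_mem (by simpa using hz)]
        linarith [norm_sub_le (φ k z) b, hB k z]
    have hind : Integrable (Uᶜ.indicator fun _ => B + ‖b‖) (μ k) :=
      (integrable_const _).indicator hm
    calc ∫ z, ‖φ k z - b‖ ∂μ k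
        ≤ ∫ z, (ε / 2 + Uᶜ.indicator (fun _ => B + ‖b‖) z) ∂μ k := by
          refine integral_mono_of_nonneg (Eventually.of_forall fun _ => norm_nonneg _)
            ((integrable_const _).add hind) (Eventually.of_forall hbd)
      _ = ε / 2 + (B + ‖b‖) * (μ k).real Uᶜ := by
          rw [integral_add (integrable_const _) hind, integral_indicator_const _ hm]
          simp [mul_comm]
      _ < ε := by linarith

lemma Concentrates.map {Z' : Type*} [TopologicalSpace Z'] [MeasurableSpace Z']
    [OpensMeasurableSpace Z'] (hμ : Concentrates μ a) {ψ : ℕ → Z → Z'}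
    (hψ : ∀ k, Measurable (ψ k)) {b : Z'}
    (h : Tendsto (fun p : ℕ × Z => ψ p.1 p.2) (atTop ×ˢ 𝓝 a) (𝓝 b)) :
    Concentrates (fun k => (μ k).map (ψ k)) b := by
  intro U hU
  obtain ⟨V, hVU, hVo, hbV⟩ := mem_nhds_iff.1 hU
  obtain ⟨p, hp, q, hq, hpq⟩ := eventually_prod_iff.1 (h (hVo.mem_nhds hbV))
  refine tendsto_of_tendsto_of_tendsto_of_le_of_le' tendsto_const_nhds (hμ {z | q z} hq)
    (Eventually.of_forall fun _ => zero_le) ?_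
  filter_upwards [hp] with k hk
  calc (μ k).map (ψ k) Uᶜ ≤ (μ k).map (ψ k) Vᶜ := measure_mono (compl_subset_compl.2 hVU)
    _ = μ k (ψ k ⁻¹' Vᶜ) := Measure.map_apply (hψ k) hVo.measurableSet.compl
    _ ≤ μ k {z | q z}ᶜ := measure_mono fun z hz hqz => hz (hpq hk hqz)

end Concentration

lemma laplace_single {n : ℕ} (P : ProbabilityMeasure (Fin n → ℝ≥0)) (i : Fin n) (t : ℝ≥0) :
    laplace P (Pi.single i t) =
      ∫ x, Real.exp (-((t : ℝ) * (x i : ℝ))) ∂(P : Measure (Fin n → ℝ≥0)) := by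
  unfold laplace
  congr 1 with x
  rw [Finset.sum_eq_single i (fun j _ hj => by simp [hj]) (by simp)]
  simp

lemma integrable_exp_neg_mul_apply {n : ℕ} (P : ProbabilityMeasure (Fin n → ℝ≥0)) (i : Fin n)
    (t : ℝ≥0) : Integrable (fun x : Fin n → ℝ≥0 => Real.exp (-((t : ℝ) * (x i : ℝ))))
      (P : Measure (Fin n → ℝ≥0)) :=
  Integrable.of_bound (by fun_prop : Continuous fun x : Fin n → ℝ≥0 =>
    Real.exp (-((t : ℝ) * (x i : ℝ)))).aestronglyMeasurable 1 (Eventually.of_forall fun x => by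
      rw [Real.norm_of_nonneg (Real.exp_pos _).le]; exact exp_neg_mul_le_one t (x i))

/-- Convergence of the Laplace transforms to that of a point mass implies concentration. -/
theorem concentrates_of_tendsto_laplace {n : ℕ} (M : ℕ → ProbabilityMeasure (Fin n → ℝ≥0))
    (h : ∀ i (t : ℝ≥0), Tendsto (fun k => laplace (M k) (Pi.single i t)) atTop
      (𝓝 (Real.exp (-t)))) :
    Concentrates (fun k => (M k : Measure (Fin n → ℝ≥0))) 1 := by
  intro U hU
  -- A continuous inverse of `x ↦ exp (-x)`: closeness of `exp (-x_i)` to `exp (-1)` for all `i`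
  -- forces `x` close to the vector of ones.
  let D : (Fin n → ℝ) → Fin n → ℝ≥0 := fun y i => (-Real.log (y i)).toNNReal
  have hD : ContinuousAt D fun _ => Real.exp (-1) := by
    refine continuousAt_pi.2 fun i => ?_
    refine continuous_real_toNNReal.continuousAt.comp (ContinuousAt.neg ?_)
    exact (continuous_apply i).continuousAt.log (Real.exp_pos _).ne'
  have hD1 : D (fun _ => Real.exp (-1)) = 1 := by ext i; simp [D]
  obtain ⟨δ, hδ, hball⟩ := Metric.mem_nhds_iff.1 (hD (by rw [hD1]; exact hU))
  -- Chebyshev's method: expanding the squares, the mean of `f` involves only the transforms at `1`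
  -- and `2` along each axis, and tends to zero.
  let f : (Fin n → ℝ≥0) → ℝ := fun x => ∑ i, (Real.exp (-(x i : ℝ)) - Real.exp (-1)) ^ 2
  have hsub : Uᶜ ⊆ {x | δ ^ 2 ≤ f x} := by
    intro x hx
    by_contra hlt
    simp only [mem_ofPred_eq, not_le] at hlt
    refine hx ?_
    have hxb : (fun i => Real.exp (-(x i : ℝ))) ∈ Metric.ball (fun _ : Fin n => Real.exp (-1)) δ := by
      rw [Metric.mem_ball, dist_pi_lt_iff hδ]
      intro i
      rw [Real.dist_eq]
      refine abs_lt_of_sq_lt_sq (lt_of_le_of_lt ?_ hlt) hδ.le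
      exact Finset.single_le_sum (f := fun i => (Real.exp (-(x i : ℝ)) - Real.exp (-1)) ^ 2)
        (fun i _ => sq_nonneg _) (Finset.mem_univ i)
    have : D (fun i => Real.exp (-(x i : ℝ))) = x := by ext i; simp [D]
    rw [← this]
    exact hball hxb
  have hterm : ∀ (i : Fin n) (x : Fin n → ℝ≥0), (Real.exp (-(x i : ℝ)) - Real.exp (-1)) ^ 2 =
      Real.exp (-(((2 : ℝ≥0) : ℝ) * (x i : ℝ))) -
        2 * Real.exp (-1) * Real.exp (-(((1 : ℝ≥0) : ℝ) * (x i : ℝ))) + Real.exp (-2) := by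
    intro i x
    have h2 : Real.exp (-2) = Real.exp (-1) ^ 2 := by rw [← Real.exp_nat_mul]; norm_num
    have h3 : Real.exp (-(((2 : ℝ≥0) : ℝ) * (x i : ℝ))) = Real.exp (-(x i : ℝ)) ^ 2 := by
      rw [← Real.exp_nat_mul]; push_cast; ring_nf
    rw [h2, h3, NNReal.coe_one, one_mul]
    ring
  have hint : ∀ k i, Integrable (fun x : Fin n → ℝ≥0 =>
      (Real.exp (-(x i : ℝ)) - Real.exp (-1)) ^ 2) (M k : Measure (Fin n → ℝ≥0)) := fun k i => by
    simp_rw [hterm]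
    exact ((integrable_exp_neg_mul_apply _ i 2).sub
      ((integrable_exp_neg_mul_apply _ i 1).const_mul _)).add (integrable_const _)
  have hval : ∀ k, ∫ x, f x ∂(M k : Measure (Fin n → ℝ≥0)) =
      ∑ i, (laplace (M k) (Pi.single i 2) -
        2 * Real.exp (-1) * laplace (M k) (Pi.single i 1) + Real.exp (-2)) := fun k => by
    simp only [f]
    rw [integral_finsetSum _ fun i _ => hint k i]
    refine Finset.sum_congr rfl fun i _ => ?_
    have hsubi : Integrable (fun x : Fin n → ℝ≥0 => Real.exp (-(((2 : ℝ≥0) : ℝ) * (x i : ℝ))) -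
        2 * Real.exp (-1) * Real.exp (-(((1 : ℝ≥0) : ℝ) * (x i : ℝ))))
        (M k : Measure (Fin n → ℝ≥0)) :=
      (integrable_exp_neg_mul_apply _ i 2).sub
        ((integrable_exp_neg_mul_apply _ i 1).const_mul _)
    simp_rw [hterm]
    rw [integral_add hsubi (integrable_const _), integral_sub (integrable_exp_neg_mul_apply _ i 2)
      ((integrable_exp_neg_mul_apply _ i 1).const_mul _), integral_const_mul,
      laplace_single, laplace_single]
    simp
  have hlim : Tendsto (fun k => ∫ x, f x ∂(M k : Measure (Fin n → ℝ≥0))) atTop (𝓝 0) := by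
    simp_rw [hval]
    have : (0 : ℝ) = ∑ _i : Fin n, (Real.exp (-((2 : ℝ≥0) : ℝ)) -
        2 * Real.exp (-1) * Real.exp (-((1 : ℝ≥0) : ℝ)) + Real.exp (-2)) := by
      refine (Finset.sum_eq_zero fun _ _ => ?_).symm
      have h2 : Real.exp (-2) = Real.exp (-1) ^ 2 := by rw [← Real.exp_nat_mul]; norm_num
      simp only [NNReal.coe_one, NNReal.coe_ofNat, h2]
      ring
    rw [this]
    exact tendsto_finsetSum _ fun i _ =>
      ((h i 2).sub ((h i 1).const_mul _)).add tendsto_const_nhds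
  have hδ2 : 0 < δ ^ 2 := by positivity
  have hle : ∀ k, (M k : Measure (Fin n → ℝ≥0)) Uᶜ ≤
      ENNReal.ofReal ((δ ^ 2)⁻¹ * ∫ x, f x ∂(M k : Measure (Fin n → ℝ≥0))) := fun k => by
    refine (measure_mono hsub).trans ?_
    rw [← ENNReal.ofReal_toReal (measure_ne_top (M k : Measure (Fin n → ℝ≥0)) _)]
    refine ENNReal.ofReal_le_ofReal ?_
    rw [inv_mul_eq_div, le_div_iff₀' hδ2]
    exact mul_meas_ge_le_integral_of_nonneg
      (Eventually.of_forall fun x => Finset.sum_nonneg fun i _ => sq_nonneg _)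
      (integrable_finsetSum _ fun i _ => hint k i) _
  refine tendsto_of_tendsto_of_tendsto_of_le_of_le tendsto_const_nhds ?_
    (fun _ => zero_le) hle
  simpa using ENNReal.tendsto_ofReal (hlim.const_mul (δ ^ 2)⁻¹)

/-- A law whose Laplace transform vanishes at infinity along an axis does not charge the
corresponding coordinate hyperplane. -/
lemma ae_pos_of_tendsto_laplace {n : ℕ} (P : ProbabilityMeasure (Fin n → ℝ≥0)) (i : Fin n)
    (h : Tendsto (fun t : ℝ≥0 => laplace P (Pi.single i t)) atTop (𝓝 0)) :
    ∀ᵐ x ∂(P : Measure (Fin n → ℝ≥0)), 0 < x i := by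
  have hm : MeasurableSet {x : Fin n → ℝ≥0 | x i = 0} :=
    measurable_pi_apply i (measurableSet_singleton 0)
  have hle : ∀ t : ℝ≥0, (P : Measure (Fin n → ℝ≥0)).real {x | x i = 0} ≤
      laplace P (Pi.single i t) := fun t => by
    rw [laplace_single, ← mul_one ((P : Measure (Fin n → ℝ≥0)).real _), ← smul_eq_mul,
      ← integral_indicator_const _ hm]
    refine integral_mono ((integrable_const _).indicator hm) (integrable_exp_neg_mul_apply P i t)
      fun x => ?_
    by_cases hx : x ∈ {x : Fin n → ℝ≥0 | x i = 0}
    · have : x i = 0 := hx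
      simp [this]
    · simp only [indicator_of_notMem hx]; positivity
  have h0 : (P : Measure (Fin n → ℝ≥0)).real {x | x i = 0} = 0 :=
    le_antisymm (ge_of_tendsto' h hle) measureReal_nonneg
  have h1 : (P : Measure (Fin n → ℝ≥0)) {x | x i = 0} = 0 := by
    rwa [measureReal_eq_zero_iff] at h0
  filter_upwards [compl_mem_ae_iff.2 h1] with x hx
  exact pos_iff_ne_zero.2 hx

/-- High roots of a positive random vector concentrate at the vector of ones. -/
lemma concentrates_map_rpow {n : ℕ} (P : ProbabilityMeasure (Fin n → ℝ≥0))
    (h : ∀ i, ∀ᵐ x ∂(P : Measure (Fin n → ℝ≥0)), 0 < x i) :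
    Concentrates (fun k : ℕ => (P : Measure (Fin n → ℝ≥0)).map
      fun x i => x i ^ (1 / ((k : ℝ) + 1))) 1 := by
  have hm : ∀ k : ℕ, Measurable fun (x : Fin n → ℝ≥0) (i : Fin n) => x i ^ (1 / ((k : ℝ) + 1)) :=
    fun k => by fun_prop
  have hae : ∀ᵐ x ∂(P : Measure (Fin n → ℝ≥0)),
      Tendsto (fun (k : ℕ) (i : Fin n) => x i ^ (1 / ((k : ℝ) + 1))) atTop (𝓝 1) := by
    filter_upwards [ae_all_iff.2 h] with x hx
    refine tendsto_pi_nhds.2 fun i => ?_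
    have h1 : Tendsto (fun k : ℕ => 1 / ((k : ℝ) + 1)) atTop (𝓝 0) :=
      tendsto_one_div_add_atTop_nhds_zero_nat
    have h2 : ContinuousAt (fun y : ℝ => x i ^ y) 0 :=
      (NNReal.continuousAt_rpow (Or.inl (hx i).ne')).comp (f := fun y : ℝ => (x i, y))
        (by fun_prop)
    simpa using! h2.tendsto.comp h1
  have htm := tendstoInMeasure_of_tendsto_ae
    (fun k => (hm k).aestronglyMeasurable) hae
  intro U hU
  obtain ⟨ε, hε, hεU⟩ := Metric.mem_nhds_iff.1 hU
  refine tendsto_of_tendsto_of_tendsto_of_le_of_le tendsto_const_nhds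
    (tendstoInMeasure_iff_dist.1 htm ε hε) (fun _ => zero_le) fun k => ?_
  refine (measure_mono (compl_subset_compl.2 hεU)).trans ?_
  rw [Measure.map_apply (hm k) Metric.isOpen_ball.measurableSet.compl]
  refine measure_mono fun x hx => ?_
  simpa only [mem_preimage, mem_compl_iff, Metric.mem_ball, not_lt, mem_ofPred_eq] using hx

/-! ### Simple scale mixtures and density -/

lemma integral_comp_simpleFunc {X Y : Type*} [MeasurableSpace X] (P : Measure X)
    [IsFiniteMeasure P] (s : SimpleFunc X Y) (G : Y → ℝ) :
    ∫ x, G (s x) ∂P = ∑ c ∈ s.range, P.real (s ⁻¹' {c}) * G c := by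
  have h1 : ∀ x, G (s x) = ∑ c ∈ s.range, (s ⁻¹' {c}).indicator (fun _ => G c) x := fun x => by
    rw [Finset.sum_eq_single (s x)]
    · simp
    · intro c _ hc
      exact indicator_of_notMem (fun h => hc (by simpa using h.symm)) _
    · intro h; exact absurd (s.mem_range_self x) h
  simp_rw [h1]
  rw [integral_finsetSum _ fun c _ => (integrable_const _).indicator (s.measurableSet_fiber c)]
  refine Finset.sum_congr rfl fun c _ => ?_
  rw [integral_indicator_const _ (s.measurableSet_fiber c), smul_eq_mul]

/-- Componentwise products of an independent simple random vector and a vector whose power is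
Erlang-subordinated stable are powers of GMML vectors. -/
theorem exists_mem_powerGMMLClass {n : ℕ} {α ν : Fin n → ℝ} (hα : ∀ i, 0 < α i)
    (hα1 : ∀ i, α i ≤ 1) (hν : ∀ i, 0 < ν i) {m : ℕ} {M : ProbabilityMeasure (Fin n → ℝ≥0)}
    (hM : ∀ u, laplace M u = (1 + ∑ i, (m + 1 : ℝ)⁻¹ * (u i : ℝ) ^ α i)⁻¹ ^ (m + 1))
    (P : ProbabilityMeasure (Fin n → ℝ≥0)) (s : SimpleFunc (Fin n → ℝ≥0) (Fin n → ℝ≥0)) :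
    ∃ Q ∈ powerGMMLClass ν α, (Q : Measure (Fin n → ℝ≥0)) =
      ((P : Measure (Fin n → ℝ≥0)).prod (M : Measure (Fin n → ℝ≥0))).map
        fun p i => s p.1 i * p.2 i ^ (1 / ν i) := by
  have hs := s.measurable
  have hsi : ∀ i, Measurable fun x => s x i := fun i => (measurable_pi_apply i).comp hs
  -- The scale enters to the power `ν` because the root `1/ν` is taken afterwards.
  let F : (Fin n → ℝ≥0) × (Fin n → ℝ≥0) → Fin n → ℝ≥0 := fun p i => s p.1 i ^ ν i * p.2 i
  have hF : Measurable F := by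
    refine measurable_pi_lambda _ fun i => ?_
    exact (((hsi i).comp measurable_fst).pow_const _).mul
      ((measurable_pi_apply i).comp measurable_snd)
  let H : (Fin n → ℝ≥0) → Fin n → ℝ≥0 := fun x i => x i ^ (1 / ν i)
  have hH : Measurable H := by fun_prop
  let P' : ProbabilityMeasure (Fin n → ℝ≥0) :=
    ⟨((P : Measure (Fin n → ℝ≥0)).prod (M : Measure (Fin n → ℝ≥0))).map F,
      Measure.isProbabilityMeasure_map hF.aemeasurable⟩
  let e := s.range.equivFin
  let c : Fin s.range.card → Fin n → ℝ≥0 := fun j => (e.symm j : Fin n → ℝ≥0)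
  let w : Fin s.range.card → ℝ := fun j => (P : Measure (Fin n → ℝ≥0)).real (s ⁻¹' {c j})
  have hsum : ∀ G : (Fin n → ℝ≥0) → ℝ,
      ∫ x, G (s x) ∂(P : Measure (Fin n → ℝ≥0)) = ∑ j, w j * G (c j) := fun G => by
    rw [integral_comp_simpleFunc, ← Finset.sum_coe_sort, ← e.symm.sum_comp]
  have hw1 : ∑ j, w j = 1 := by simpa using (hsum fun _ => 1).symm
  let r : Fin s.range.card → Fin n → ℝ := fun j i => (m + 1 : ℝ)⁻¹ * ((c j i : ℝ) ^ ν i) ^ α i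
  have hr : ∀ j i, 0 ≤ r j i := fun j i => by positivity
  have hP' : IsGMML α (erlangInit m w) (erlangRate s.range.card m)
      (Matrix.of fun k => r (finProdFinEquiv.symm k : Fin s.range.card × Fin (m + 1)).1) P' := by
    refine ⟨hα, hα1, isPhaseTypeRep_erlang m (fun _ => measureReal_nonneg) hw1,
      fun k i => hr _ _, fun u => ?_⟩
    rw [gmmlTransform_erlang m α w hr u]
    have hL : laplace P' u = ∫ x, laplace M (fun i => u i * s x i ^ ν i)
        ∂(P : Measure (Fin n → ℝ≥0)) := by
      unfold laplace
      have hint : Integrable (fun z => Real.exp (-∑ i, (u i : ℝ) * (F z i : ℝ)))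
          ((P : Measure (Fin n → ℝ≥0)).prod (M : Measure (Fin n → ℝ≥0))) :=
        Integrable.of_bound ((continuous_exp_neg_sum u).measurable.comp hF).aestronglyMeasurable 1
          (Eventually.of_forall fun z => norm_exp_neg_sum_le_one u (F z))
      rw [ProbabilityMeasure.coe_mk, integral_map hF.aemeasurable
        (continuous_exp_neg_sum u).aestronglyMeasurable, integral_prod _ hint]
      simp only [F, NNReal.coe_mul, mul_assoc]
    rw [hL]
    simp_rw [hM]
    rw [hsum fun y => (1 + ∑ i, (m + 1 : ℝ)⁻¹ * ((u i * y i ^ ν i : ℝ≥0) : ℝ) ^ α i)⁻¹ ^ (m + 1)]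
    refine Finset.sum_congr rfl fun j _ => ?_
    congr 4
    refine Finset.sum_congr rfl fun i _ => ?_
    simp only [r]
    rw [NNReal.coe_mul, Real.mul_rpow (u i).coe_nonneg (NNReal.coe_nonneg _), NNReal.coe_rpow]
    ring
  refine ⟨⟨(P' : Measure (Fin n → ℝ≥0)).map H, Measure.isProbabilityMeasure_map hH.aemeasurable⟩,
    ⟨_, _, _, _, hν, P', hP', rfl⟩, ?_⟩
  rw [ProbabilityMeasure.coe_mk, ProbabilityMeasure.coe_mk, Measure.map_map hH hF]
  congr 1
  ext p i
  simp only [Function.comp_apply, H, F]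
  rw [NNReal.mul_rpow, ← NNReal.rpow_mul, mul_one_div_cancel (hν i).ne', NNReal.rpow_one]

/-- A class of distributions is dense if it contains the classes `GMML^(1/ν)(α, ·, ·, ·)` along
a sequence of parameters for which the normalized vectors concentrate at the vector of ones. -/
theorem dense_of_concentrates {n : ℕ} {C : Set (ProbabilityMeasure (Fin n → ℝ≥0))}
    {α ν : ℕ → Fin n → ℝ} (hα : ∀ k i, 0 < α k i) (hα1 : ∀ k i, α k i ≤ 1)
    (hν : ∀ k i, 0 < ν k i) {m : ℕ → ℕ} {M : ℕ → ProbabilityMeasure (Fin n → ℝ≥0)}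
    (hM : ∀ k u, laplace (M k) u =
      (1 + ∑ i, (m k + 1 : ℝ)⁻¹ * (u i : ℝ) ^ α k i)⁻¹ ^ (m k + 1))
    (hconc : Concentrates (fun k => (M k : Measure (Fin n → ℝ≥0)).map
      fun x i => x i ^ (1 / ν k i)) 1)
    (hC : ∀ k, powerGMMLClass (ν k) (α k) ⊆ C) : Dense C := by
  intro P
  let s : ℕ → SimpleFunc (Fin n → ℝ≥0) (Fin n → ℝ≥0) := fun k =>
    SimpleFunc.approxOn id measurable_id univ 0 (mem_univ _) k
  have hs : ∀ x, Tendsto (fun k => s k x) atTop (𝓝 x) := fun x =>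
    SimpleFunc.tendsto_approxOn measurable_id (mem_univ _) (by simp)
  choose Q hQ hQeq using fun k =>
    exists_mem_powerGMMLClass (hα k) (hα1 k) (hν k) (hM k) P (s k)
  refine mem_closure_of_tendsto (f := Q) (b := atTop) ?_ (Eventually.of_forall fun k => hC k (hQ k))
  rw [ProbabilityMeasure.tendsto_iff_forall_integral_tendsto]
  intro f
  have hH : ∀ k, Measurable fun (x : Fin n → ℝ≥0) i => x i ^ (1 / ν k i) := fun k => by fun_prop
  have hF : ∀ k, Measurable fun (p : (Fin n → ℝ≥0) × (Fin n → ℝ≥0)) i =>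
      s k p.1 i * p.2 i ^ (1 / ν k i) := fun k => by
    refine measurable_pi_lambda _ fun i => ?_
    exact (((measurable_pi_apply i).comp (s k).measurable).comp measurable_fst).mul
      (((measurable_pi_apply i).comp measurable_snd).pow_const _)
  have hint : ∀ k, Integrable (fun p : (Fin n → ℝ≥0) × (Fin n → ℝ≥0) =>
      f fun i => s k p.1 i * p.2 i ^ (1 / ν k i))
      ((P : Measure (Fin n → ℝ≥0)).prod (M k : Measure (Fin n → ℝ≥0))) := fun k =>
    Integrable.of_bound (f.continuous.measurable.comp (hF k)).aestronglyMeasurable ‖f‖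
      (Eventually.of_forall fun _ => f.norm_coe_le_norm _)
  have heq : ∀ k, ∫ y, f y ∂(Q k : Measure (Fin n → ℝ≥0)) =
      ∫ x, ∫ z, f (fun i => s k x i * z i ^ (1 / ν k i)) ∂(M k : Measure (Fin n → ℝ≥0))
        ∂(P : Measure (Fin n → ℝ≥0)) := fun k => by
    rw [hQeq k, integral_map (hF k).aemeasurable f.continuous.aestronglyMeasurable,
      integral_prod _ (hint k)]
  simp_rw [heq]
  -- Dominated convergence handles the outer integral; for fixed `x` the inner one converges to `f
  -- x` by concentration, since `s k x → x`.
  refine tendsto_integral_of_dominated_convergence (fun _ => ‖f‖)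
    (fun k => (hint k).integral_prod_left.aestronglyMeasurable) (integrable_const _)
    (fun k => Eventually.of_forall fun x => ?_) (Eventually.of_forall fun x => ?_)
  · refine (norm_integral_le_of_norm_le_const
      (Eventually.of_forall fun _ => f.norm_coe_le_norm _)).trans ?_
    simp
  · have : ∀ k, IsProbabilityMeasure ((M k : Measure (Fin n → ℝ≥0)).map
        fun x i => x i ^ (1 / ν k i)) := fun k =>
      Measure.isProbabilityMeasure_map (hH k).aemeasurable
    have hc : ∀ k, Continuous fun y : Fin n → ℝ≥0 => f fun i => s k x i * y i := fun k =>
      f.continuous.comp (by fun_prop)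
    have key := hconc.tendsto_integral (φ := fun k y => f fun i => s k x i * y i) (b := f x)
      (fun k => (hc k).measurable) (fun k y => f.norm_coe_le_norm _) (by
        refine (f.continuous.tendsto x).comp ?_
        have h1 : Tendsto (fun p : ℕ × (Fin n → ℝ≥0) => s p.1 x) (atTop ×ˢ 𝓝 1) (𝓝 x) :=
          (hs x).comp tendsto_fst
        simpa using! h1.mul (tendsto_snd (f := (atTop : Filter ℕ)) (g := 𝓝 (1 : Fin n → ℝ≥0))))
    refine key.congr fun k => ?_
    rw [integral_map (hH k).aemeasurable (hc k).aestronglyMeasurable]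

lemma tendsto_laplace_single {n : ℕ} {α : ℕ → Fin n → ℝ} (hα : ∀ k i, 0 < α k i)
    (hlim : ∀ i, Tendsto (fun k => α k i) atTop (𝓝 1))
    {M : ℕ → ProbabilityMeasure (Fin n → ℝ≥0)}
    (hM : ∀ k u, laplace (M k) u =
      (1 + ∑ i, (k + 1 : ℝ)⁻¹ * (u i : ℝ) ^ α k i)⁻¹ ^ (k + 1)) (i : Fin n) (t : ℝ≥0) :
    Tendsto (fun k => laplace (M k) (Pi.single i t)) atTop (𝓝 (Real.exp (-t))) := by
  have h1 : ∀ k, laplace (M k) (Pi.single i t) =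
      ((1 + (k + 1 : ℝ)⁻¹ * (t : ℝ) ^ α k i) ^ (k + 1))⁻¹ := fun k => by
    rw [hM, inv_pow, Finset.sum_eq_single i (fun j _ hj => by
      simp [hj, Real.zero_rpow (hα k j).ne']) (by simp)]
    simp
  simp_rw [h1, Real.exp_neg]
  refine Tendsto.inv₀ ?_ (Real.exp_pos _).ne'
  have h2 : Tendsto (fun k => (t : ℝ) ^ α k i) atTop (𝓝 (t : ℝ)) := by
    have := (Real.continuousAt_const_rpow' (a := (t : ℝ)) one_ne_zero).tendsto.comp (hlim i)
    simpa using! this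
  -- Reindexed by `n = k + 1`; the truncated subtraction at `n = 0` does not affect the limit.
  have h3 : Tendsto (fun n : ℕ => (1 + (n : ℝ)⁻¹ * (t : ℝ) ^ α (n - 1) i) ^ n) atTop
      (𝓝 (Real.exp t)) := by
    refine Real.tendsto_one_add_pow_exp_of_tendsto ?_
    refine (h2.comp (tendsto_sub_atTop_nat 1)).congr' ?_
    filter_upwards [eventually_gt_atTop 0] with n hn
    have : (n : ℝ) ≠ 0 := by positivity
    simp only [Function.comp_apply]
    field_simp
  simpa [Function.comp_def] using h3.comp (tendsto_add_atTop_nat 1)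

/-- Density for indices tending to one and exponents tending to positive limits. -/
theorem dense_of_tendsto_one {n : ℕ} {C : Set (ProbabilityMeasure (Fin n → ℝ≥0))}
    {α ν : ℕ → Fin n → ℝ} (hα : ∀ k i, 0 < α k i) (hα1 : ∀ k i, α k i ≤ 1)
    (hν : ∀ k i, 0 < ν k i) (hlim : ∀ i, Tendsto (fun k => α k i) atTop (𝓝 1))
    {β : Fin n → ℝ} (hνlim : ∀ i, Tendsto (fun k => 1 / ν k i) atTop (𝓝 (β i)))
    (hC : ∀ k, powerGMMLClass (ν k) (α k) ⊆ C) : Dense C := by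
  choose M hM using fun k => exists_laplace_eq_inv_pow (hα k) (hα1 k) k
  refine dense_of_concentrates hα hα1 hν hM ?_ hC
  refine (concentrates_of_tendsto_laplace M (tendsto_laplace_single hα hlim hM)).map
    (fun k => by fun_prop) ?_
  refine tendsto_pi_nhds.2 fun i => ?_
  have h1 : Tendsto (fun p : ℕ × (Fin n → ℝ≥0) => (p.2 i, 1 / ν p.1 i)) (atTop ×ˢ 𝓝 1)
      (𝓝 ((1 : ℝ≥0), β i)) :=
    (((continuous_apply i).tendsto (1 : Fin n → ℝ≥0)).comp tendsto_snd).prodMk_nhds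
      ((hνlim i).comp tendsto_fst)
  simpa using! (NNReal.continuousAt_rpow (x := (1 : ℝ≥0)) (y := β i)
    (Or.inl one_ne_zero)).tendsto.comp h1

/-- Density for fixed indices and exponents tending to infinity. -/
theorem dense_of_fixed_index {n : ℕ} {C : Set (ProbabilityMeasure (Fin n → ℝ≥0))}
    {α : Fin n → ℝ} (hα : ∀ i, 0 < α i) (hα1 : ∀ i, α i ≤ 1)
    (hC : ∀ k : ℕ, powerGMMLClass (fun _ => (k : ℝ) + 1) α ⊆ C) : Dense C := by
  obtain ⟨M, hM⟩ := exists_laplace_eq_inv_pow hα hα1 0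
  refine dense_of_concentrates (α := fun _ => α) (ν := fun k _ => (k : ℝ) + 1) (m := fun _ => 0)
    (M := fun _ => M) (fun _ => hα) (fun _ => hα1) (fun k i => by positivity) (fun _ => hM)
    (concentrates_map_rpow M fun i => ae_pos_of_tendsto_laplace M i ?_) hC
  have h1 : ∀ t : ℝ≥0, laplace M (Pi.single i t) = (1 + (t : ℝ) ^ α i)⁻¹ := fun t => by
    rw [hM, Finset.sum_eq_single i (fun j _ hj => by
      simp [hj, Real.zero_rpow (hα j).ne']) (by simp)]
    simp
  simp_rw [h1]
  refine tendsto_inv_atTop_zero.comp (tendsto_atTop_add_const_left _ _ ?_)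
  exact (tendsto_rpow_atTop (hα i)).comp (NNReal.tendsto_coe_atTop.2 tendsto_id)

end MatrixMittagLeffler

theorem theorem4p10 (n : ℕ) :
    Dense (MatrixMittagLeffler.gmmlClass n) ∧
    (∀ α : Fin n → ℝ, (∀ i, 0 < α i ∧ α i ≤ 1) →
      Dense {Q : ProbabilityMeasure (Fin n → ℝ≥0) |
        ∃ ν : Fin n → ℝ, Q ∈ MatrixMittagLeffler.powerGMMLClass ν α}) ∧
    (∀ γ : Fin n → ℝ, (∀ i, 0 < γ i) →
      Dense {Q : ProbabilityMeasure (Fin n → ℝ≥0) |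
        ∃ ν α : Fin n → ℝ, (∀ i, α i < 1) ∧ (∀ i, α i * ν i = (γ i)⁻¹) ∧
          Q ∈ MatrixMittagLeffler.powerGMMLClass ν α}) := by
  refine ⟨?_, fun α hα => ?_, fun γ hγ => ?_⟩
  -- Already `α = 1` suffices for (i), and with `ν = 1` the root is the identity.
  · refine MatrixMittagLeffler.dense_of_tendsto_one (α := fun _ _ => 1) (ν := fun _ _ => 1)
      (β := fun _ => 1) (by simp) (by simp) (by simp) (by simp) (by simp) fun _ Q hQ => ?_
    obtain ⟨p, π, T, R, -, P, hP, hQP⟩ := hQ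
    have : Q = P := by
      refine Subtype.ext (hQP.trans ?_)
      simp
    exact ⟨_, p, π, T, R, this ▸ hP⟩
  · exact MatrixMittagLeffler.dense_of_fixed_index (fun i => (hα i).1) (fun i => (hα i).2)
      fun k Q hQ => ⟨_, hQ⟩
  · have h0 : ∀ k : ℕ, (0 : ℝ) < 1 - 1 / ((k : ℝ) + 2) := fun k => by
      rw [sub_pos, div_lt_one (by positivity)]
      linarith [(Nat.cast_nonneg k : (0 : ℝ) ≤ k)]
    have h1 : ∀ k : ℕ, 1 - 1 / ((k : ℝ) + 2) < 1 := fun k => sub_lt_self _ (by positivity)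
    have hlim : Filter.Tendsto (fun k : ℕ => 1 - 1 / ((k : ℝ) + 2)) Filter.atTop (nhds 1) := by
      have h2 : Filter.Tendsto (fun k : ℕ => (k : ℝ) + 2) Filter.atTop Filter.atTop :=
        Filter.tendsto_atTop_add_const_right _ _ tendsto_natCast_atTop_atTop
      simpa using (tendsto_const_nhds (x := (1 : ℝ))).sub (h2.const_div_atTop 1)
    -- The shift by `2` keeps the index in `(0, 1)` even at `k = 0`. The constraint forces `1/ν = α
    -- γ`, which tends to `γ`.
    refine MatrixMittagLeffler.dense_of_tendsto_one (α := fun k _ => 1 - 1 / ((k : ℝ) + 2))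
      (ν := fun k i => ((1 - 1 / ((k : ℝ) + 2)) * γ i)⁻¹) (β := γ) (fun k _ => h0 k)
      (fun k _ => (h1 k).le) (fun k i => inv_pos.2 (mul_pos (h0 k) (hγ i))) (fun _ => hlim)
      (fun i => ?_) fun k Q hQ => ⟨_, _, fun _ => h1 k, fun i => ?_, hQ⟩
    · simpa using hlim.mul_const (γ i)
    · have := (h0 k).ne'
      rw [mul_inv, mul_inv_cancel_left₀ this]
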